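/- Let $K$ be a field, $n\ge 0$, and let $\Delta$ be a simplicial complex on $\{x_1,\ldots,x_n\}$, that is, a collection of subsets of $\{x_1,\ldots,x_n\}$ which contains $\emptyset$ and is closed under taking subsets (it is not required that every $\{x_i\}$ belongs to $\Delta$). Let $S=K[x_1,\ldots,x_n,y_1,\ldots,y_n]$ with the standard grading, and let the face ideal $J_\Delta\subseteq S$ be the ideal generated by the monomials $$u_F=\prod_{x_i\in F}x_i\prod_{x_j\in\{x_1,\ldots,x_n\}\setminus F}y_j,\qquad F\in\Delta.$$ Then $J_\Delta$ has a linear resolution, i.e. there is an integer $d\ge 0$ such that the minimal graded free resolution of $J_\Delta$ over $S$ has the form $$\cdots\to S(-d-2)^{b_2}\to S(-d-1)^{b_1}\to S(-d)^{b_0}\to J_\Delta\to 0 .$$ -/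

import Mathlib

/-! ### Graded free resolutions and linear resolutions over a standard graded polynomial ring -/

/-- Let `S = K[x_s : s ∈ σ]` be standard graded and let `a : ι → ℤ`.  The vector `v ∈ S^ι` is
homogeneous of degree `j` in the graded free module `⨁_{k ∈ ι} S(-a k)`, whose `k`-th basis vector
sits in degree `a k`: every monomial of the `k`-th coordinate of `v` has degree `j - a k`.
The zero vector is homogeneous of every degree. -/
def IsHomogeneousVector {K σ ι : Type*} [Field K] (a : ι → ℤ) (j : ℤ)
    (v : ι → MvPolynomial σ K) : Prop :=
  ∀ k, ∀ m ∈ (v k).support, (m.degree : ℤ) + a k = j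

/-- A graded free resolution
`⋯ → F₂ → F₁ → F₀ → I → 0` of an ideal `I` of `S = K[x_s : s ∈ σ]`, by finitely generated graded
free modules `F_i = ⨁_{k ∈ ι i} S(-deg i k)` and homogeneous maps of degree `0`. -/
structure GradedFreeResolution {K σ : Type*} [Field K] (I : Ideal (MvPolynomial σ K)) where
  /-- the index set of the homogeneous basis of `F_i` -/
  ι : ℕ → Type
  /-- every `F_i` has finite rank -/
  finite_ι : ∀ i, Finite (ι i)
  /-- the degrees of the basis elements of `F_i` -/
  deg : ∀ i, ι i → ℤ
  /-- the augmentation `F₀ → I`, as a map to `S` -/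
  aug : (ι 0 → MvPolynomial σ K) →ₗ[MvPolynomial σ K] MvPolynomial σ K
  /-- the differentials `F_{i+1} → F_i` -/
  d : ∀ i, (ι (i + 1) → MvPolynomial σ K) →ₗ[MvPolynomial σ K] (ι i → MvPolynomial σ K)
  /-- the augmentation preserves degrees -/
  aug_homogeneous : ∀ (j : ℤ) (v : ι 0 → MvPolynomial σ K),
    IsHomogeneousVector (deg 0) j v → ∀ m ∈ (aug v).support, (m.degree : ℤ) = j
  /-- the differentials preserve degrees -/
  d_homogeneous : ∀ (i : ℕ) (j : ℤ) (v : ι (i + 1) → MvPolynomial σ K),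
    IsHomogeneousVector (deg (i + 1)) j v → IsHomogeneousVector (deg i) j (d i v)
  /-- the augmentation maps onto `I` -/
  range_aug : LinearMap.range aug = I
  /-- exactness at `F₀` -/
  exact_aug : Function.Exact (d 0) aug
  /-- exactness at `F_{i+1}` -/
  exact_d : ∀ i, Function.Exact (d (i + 1)) (d i)

/-- The resolution is minimal: `d (F_{i+1}) ⊆ 𝔪 F_i` for all `i`, where `𝔪` is the ideal generated
by the variables, that is, the ideal of polynomials with zero constant coefficient. -/
def GradedFreeResolution.IsMinimal {K σ : Type*} [Field K] {I : Ideal (MvPolynomial σ K)}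
    (R : GradedFreeResolution I) : Prop :=
  ∀ (i : ℕ) (v : R.ι (i + 1) → MvPolynomial σ K) (k : R.ι i),
    MvPolynomial.constantCoeff (R.d i v k) = 0

/-- `I` has a linear resolution: for some `d`, its minimal graded free resolution has the form
`⋯ → S(-d-2)^{b₂} → S(-d-1)^{b₁} → S(-d)^{b₀} → I → 0`. -/
def HasLinearResolution {K σ : Type*} [Field K] (I : Ideal (MvPolynomial σ K)) : Prop :=
  ∃ (d : ℕ) (R : GradedFreeResolution I), R.IsMinimal ∧
    ∀ (i : ℕ) (k : R.ι i), R.deg i k = (d : ℤ) + i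

/-! ### Face ideals

`MvPolynomial (Fin n ⊕ Fin n) K` is the polynomial ring `K[x_1, …, x_n, y_1, …, y_n]`, with
`x_i = X (Sum.inl i)` and `y_i = X (Sum.inr i)`. -/

/-- The monomial `u_F = ∏_{i ∈ F} x_i ∏_{i ∉ F} y_i`. -/
noncomputable def faceMonomial (K : Type*) [Field K] {n : ℕ} (F : Finset (Fin n)) :
    MvPolynomial (Fin n ⊕ Fin n) K :=
  (∏ i ∈ F, MvPolynomial.X (Sum.inl i)) * ∏ i ∈ Fᶜ, MvPolynomial.X (Sum.inr i)

/-- The face ideal `J_Δ`, generated by the monomials `u_F`, where `F` runs through the faces of `Δ`.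
The empty set counts as a face here; it is inserted, since the set `Δ.faces` of Mathlib lists the
non-empty faces only. -/
noncomputable def faceIdeal (K : Type*) [Field K] {n : ℕ}
    (Δ : PreAbstractSimplicialComplex (Fin n)) : Ideal (MvPolynomial (Fin n ⊕ Fin n) K) :=
  Ideal.span (faceMonomial K '' insert ∅ Δ.faces)

/-!
The ideal `J_Δ` has an explicit minimal resolution, supported on a cubical complex. The faces of
`Δ`, viewed as `0`-`1`-vectors, are vertices of the cube `[0, 1]ⁿ`; let `X` consist of the faces of
the cube all of whose vertices belong to `Δ`. Such a face is given by its largest vertex `F ∈ Δ` and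
its set of directions `G ⊆ F`, and it is labelled by the least common multiple of the monomials
`u_F'` at its vertices, which is `u_F ∏_{j ∈ G} y_j`. In the complex of free modules on the faces of
`X`, the label of a face `(F, G)` is `y_j` times the label of its upper facet `(F, G \ j)` and `x_j`
times that of its lower facet `(F \ j, G \ j)`. So the boundary has linear coefficients, the
`i`-dimensional faces have degree `n + i`, and the complex is linear and minimal as soon as it is
exact.

Exactness comes from a homotopy in each direction `j` (`cubeHomotopy`): it divides a coefficient by
`y_j`, dropping the monomials not divisible by `y_j`, and sweeps `(F, G)` with `j ∈ F \ G` to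
`(F, G ∪ j)`. As the largest vertex does not change, this stays inside `X`. It anticommutes with the
parts of the boundary in the other directions, and hence it replaces a cycle by a homologous one
that is *reduced* in direction `j`: no face occurring in it contains the direction `j`, and the
coefficients on the upper facet of the cube have no monomial divisible by `y_j`
(`isReducedIn_sub_totalBoundary_cubeHomotopy`). Reductions in different directions do not disturb
each other, so every cycle is homologous to one that is reduced in every direction
(`exists_isReducedIn_sub_totalBoundary`). In positive dimension such a cycle is zero, and on reduced
chains of dimension `0` the augmentation is injective, because `F` can be recovered from `m u_F`
when no `y_j` with `j ∈ F` divides `m` (`eq_zero_of_cubeAugmentation_eq_zero`).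

The chains are encoded as functions on all pairs of finsets, so that the operators can be written
down without dependent types; the modules of the resolution are obtained by restriction.
-/

/-! ### Division of polynomials by a variable -/

section Division

variable {σ K : Type*} [Field K]

/-- Division by the variable `X s`, as an additive map: monomials not divisible by `X s` are sent
to zero. -/
noncomputable def divX (s : σ) : MvPolynomial σ K →+ MvPolynomial σ K where
  toFun p := p.divMonomial (Finsupp.single s 1)
  map_zero' := MvPolynomial.zero_divMonomial _
  map_add' p q := MvPolynomial.add_divMonomial p q _

lemma coeff_divX (s : σ) (p : MvPolynomial σ K) (m : σ →₀ ℕ) :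
    MvPolynomial.coeff m (divX s p) = MvPolynomial.coeff (Finsupp.single s 1 + m) p := rfl

lemma divX_X_mul_self (s : σ) (p : MvPolynomial σ K) : divX s (MvPolynomial.X s * p) = p :=
  MvPolynomial.divMonomial_monomial_mul _ p

lemma divX_X_mul_of_ne {s t : σ} (h : s ≠ t) (p : MvPolynomial σ K) :
    divX s (MvPolynomial.X t * p) = MvPolynomial.X t * divX s p := by
  classical
  ext m
  have hs : t ∈ (Finsupp.single s 1 + m).support ↔ t ∈ m.support := by
    simp [Finsupp.single_eq_of_ne h.symm]
  rw [coeff_divX, MvPolynomial.coeff_X_mul', MvPolynomial.coeff_X_mul', coeff_divX]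
  by_cases ht : t ∈ m.support
  · rw [if_pos (hs.2 ht), if_pos ht, add_tsub_assoc_of_le]
    simpa [Nat.one_le_iff_ne_zero] using ht
  · rw [if_neg (mt hs.1 ht), if_neg ht]

lemma divX_comm (s t : σ) (p : MvPolynomial σ K) : divX s (divX t p) = divX t (divX s p) := by
  ext m
  simp only [coeff_divX, add_left_comm]

/-- Subtracting its multiple `X s * divX s p` of `X s` from `p` removes all monomials divisible by
`X s`. -/
lemma divX_sub_X_mul_divX (s : σ) (p : MvPolynomial σ K) :
    divX s (p - MvPolynomial.X s * divX s p) = 0 := by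
  rw [map_sub, divX_X_mul_self, sub_self]

end Division

/-! ### The operators of the cubical complex in a single direction -/

section Cube

variable {K : Type*} [Field K] {n : ℕ}

/-- Chains on the cube `[0, 1]ⁿ`, with coefficients in `K[x_1, …, x_n, y_1, …, y_n]`. A pair
`(F, G)` of finsets stands for the face of the cube whose directions are the elements of `G` and
whose largest vertex is `F`. It is a genuine face of the cube only if `G ⊆ F`; the other pairs are
kept as junk so that no dependent types occur. -/
abbrev CubeChain (K : Type*) [Field K] (n : ℕ) : Type _ :=
  Finset (Fin n) → Finset (Fin n) → MvPolynomial (Fin n ⊕ Fin n) K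

/-- The sign of the direction `j` relative to the set of directions `G`. -/
def cubeSign (j : Fin n) (G : Finset (Fin n)) : ℤ := (-1) ^ (G.filter (· < j)).card

lemma cubeSign_mul_self (j : Fin n) (G : Finset (Fin n)) : cubeSign j G * cubeSign j G = 1 := by
  rw [cubeSign, ← mul_pow]
  norm_num

lemma cubeSign_insert_self (j : Fin n) (G : Finset (Fin n)) :
    cubeSign j (insert j G) = cubeSign j G := by
  simp [cubeSign, Finset.filter_insert]

lemma cubeSign_erase_self (j : Fin n) (G : Finset (Fin n)) :
    cubeSign j (G.erase j) = cubeSign j G := by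
  simp [cubeSign, Finset.filter_erase]

lemma cubeSign_insert {j k : Fin n} {G : Finset (Fin n)} (hk : k ∉ G) :
    cubeSign j (insert k G) = (if k < j then -1 else 1) * cubeSign j G := by
  unfold cubeSign
  rw [Finset.filter_insert]
  split_ifs
  · rw [Finset.card_insert_of_notMem (by simp [hk]), pow_succ']
  · rw [one_mul]

lemma cubeSign_anticomm {j k : Fin n} {G : Finset (Fin n)} (hjk : j ≠ k) (hj : j ∉ G)
    (hk : k ∉ G) :
    cubeSign j G * cubeSign k (insert j G) = -(cubeSign k G * cubeSign j (insert k G)) := by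
  rw [cubeSign_insert hj, cubeSign_insert hk]
  rcases lt_or_gt_of_ne hjk with h | h
  · rw [if_pos h, if_neg h.not_gt]; ring
  · rw [if_pos h, if_neg h.not_gt]; ring

/-- The coefficient with which a face of the cube occurs, up to the sign of the direction, in the
boundary of the face obtained by adding the direction `j`: it is `y_j` for the upper facet and
`-x_j` for the lower one. -/
noncomputable def facetCoeff (K : Type*) [Field K] (j : Fin n) (F : Finset (Fin n)) :
    MvPolynomial (Fin n ⊕ Fin n) K :=
  if j ∈ F then MvPolynomial.X (Sum.inr j) else -MvPolynomial.X (Sum.inl j)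

lemma facetCoeff_insert {j k : Fin n} (h : j ≠ k) (F : Finset (Fin n)) :
    facetCoeff K j (insert k F) = facetCoeff K j F := by
  simp [facetCoeff, h]

lemma divX_facetCoeff_mul {j k : Fin n} (h : j ≠ k) (F : Finset (Fin n))
    (p : MvPolynomial (Fin n ⊕ Fin n) K) :
    divX (Sum.inr j) (facetCoeff K k F * p) = facetCoeff K k F * divX (Sum.inr j) p := by
  unfold facetCoeff
  split_ifs
  · exact divX_X_mul_of_ne (by simpa using h) p
  · rw [neg_mul, map_neg, divX_X_mul_of_ne (by simp), neg_mul]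

/-- The part of the boundary of cubical chains that collapses the direction `j`. -/
noncomputable def cubeBoundary (j : Fin n) :
    CubeChain K n →ₗ[MvPolynomial (Fin n ⊕ Fin n) K] CubeChain K n where
  toFun v F G :=
    if j ∈ G then 0 else cubeSign j G • (facetCoeff K j F * v (insert j F) (insert j G))
  map_add' v w := by
    ext1 F; ext1 G
    simp only [Pi.add_apply]
    split_ifs <;> simp [mul_add]
  map_smul' a v := by
    ext1 F; ext1 G
    simp only [Pi.smul_apply, smul_eq_mul, RingHom.id_apply]
    split_ifs
    · simp
    · rw [mul_smul_comm, mul_left_comm]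

lemma cubeBoundary_apply (j : Fin n) (v : CubeChain K n) (F G : Finset (Fin n)) :
    cubeBoundary j v F G =
      if j ∈ G then 0 else cubeSign j G • (facetCoeff K j F * v (insert j F) (insert j G)) := rfl

/-- The homotopy in direction `j`: it divides by `y_j` and sweeps every face not containing the
direction `j`, but lying in the upper facet of the cube in this direction, along `j`. -/
noncomputable def cubeHomotopy (j : Fin n) : CubeChain K n →+ CubeChain K n where
  toFun v F G :=
    if j ∈ F ∧ j ∈ G then cubeSign j G • divX (Sum.inr j) (v F (G.erase j)) else 0
  map_zero' := by
    ext1 F; ext1 G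
    simp
  map_add' v w := by
    ext1 F; ext1 G
    simp only [Pi.add_apply]
    split_ifs <;> simp

lemma cubeHomotopy_apply (j : Fin n) (v : CubeChain K n) (F G : Finset (Fin n)) :
    cubeHomotopy j v F G =
      if j ∈ F ∧ j ∈ G then cubeSign j G • divX (Sum.inr j) (v F (G.erase j)) else 0 := rfl

lemma cubeBoundary_cubeBoundary_self (j : Fin n) (v : CubeChain K n) :
    cubeBoundary j (cubeBoundary j v) = 0 := by
  ext1 F; ext1 G
  simp [cubeBoundary_apply]

lemma cubeBoundary_anticomm {j k : Fin n} (h : j ≠ k) (v : CubeChain K n) :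
    cubeBoundary j (cubeBoundary k v) + cubeBoundary k (cubeBoundary j v) = 0 := by
  ext1 F; ext1 G
  simp only [Pi.add_apply, cubeBoundary_apply, Pi.zero_apply, Finset.mem_insert, h, h.symm,
    false_or]
  by_cases hj : j ∈ G
  · simp [hj]
  by_cases hk : k ∈ G
  · simp [hk]
  simp only [hj, hk, if_false]
  rw [facetCoeff_insert h, facetCoeff_insert h.symm, Finset.insert_comm k j F,
    Finset.insert_comm k j G, mul_smul_comm, mul_smul_comm, smul_smul, smul_smul,
    cubeSign_anticomm h hj hk, mul_left_comm, neg_smul, neg_add_cancel]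

lemma cubeHomotopy_cubeBoundary_anticomm {j k : Fin n} (h : j ≠ k) (v : CubeChain K n) :
    cubeHomotopy j (cubeBoundary k v) + cubeBoundary k (cubeHomotopy j v) = 0 := by
  ext1 F; ext1 G
  simp only [Pi.add_apply, cubeBoundary_apply, cubeHomotopy_apply, Pi.zero_apply,
    Finset.mem_insert, h, h.symm, false_or, Finset.mem_erase, ne_eq, not_false_eq_true, true_and]
  by_cases hk : k ∈ G
  · simp [hk]
  by_cases hj : j ∈ F ∧ j ∈ G
  · simp only [hk, hj, if_false, and_self, if_true]
    obtain ⟨G', hjG', rfl⟩ : ∃ G', j ∉ G' ∧ insert j G' = G :=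
      ⟨G.erase j, by simp, Finset.insert_erase hj.2⟩
    have hkG' : k ∉ G' := fun hh => hk (Finset.mem_insert_of_mem hh)
    rw [Finset.insert_comm k j G', Finset.erase_insert hjG',
      Finset.erase_insert (by simp [h, hjG']), cubeSign_insert_self, map_zsmul,
      divX_facetCoeff_mul h, mul_smul_comm, smul_smul, smul_smul,
      ← add_smul, cubeSign_insert_self, cubeSign_insert hjG', cubeSign_insert hkG']
    convert zero_smul ℤ _
    rcases lt_or_gt_of_ne h with h' | h'
    · rw [if_pos h', if_neg h'.not_gt]; ring
    · rw [if_pos h', if_neg h'.not_gt]; ring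
  · simp [hj]

/-- The chain homotopy in direction `j` deforms the identity to the operator on the right. The case
`j ∈ G`, `j ∉ F` concerns pairs which are not faces of the cube. -/
lemma cubeHomotopy_cubeBoundary_self (j : Fin n) (v : CubeChain K n) (F G : Finset (Fin n)) :
    (v - cubeBoundary j (cubeHomotopy j v) - cubeHomotopy j (cubeBoundary j v)) F G =
      if j ∈ G then (if j ∈ F then 0 else v F G) else
        v F G - facetCoeff K j F * divX (Sum.inr j) (v (insert j F) G) := by
  simp only [Pi.sub_apply, cubeBoundary_apply, cubeHomotopy_apply]
  by_cases hG : j ∈ G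
  · by_cases hF : j ∈ F
    · simp [-zsmul_eq_mul, hG, hF, facetCoeff, divX_X_mul_self, smul_smul, cubeSign_erase_self,
        cubeSign_mul_self, Finset.insert_erase]
    · simp [hG, hF]
  · simp [-zsmul_eq_mul, hG, smul_smul, cubeSign_insert_self, cubeSign_mul_self]

end Cube

/-! ### Acyclicity of the cubical complex of a lower set of vertices -/

section Acyclic

variable {K : Type*} [Field K] {n : ℕ}

/-- The boundary of cubical chains, with the facets weighted by `y_j` and `-x_j`. -/
noncomputable def totalBoundary (K : Type*) [Field K] (n : ℕ) :
    CubeChain K n →ₗ[MvPolynomial (Fin n ⊕ Fin n) K] CubeChain K n :=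
  ∑ j, cubeBoundary j

lemma totalBoundary_apply (v : CubeChain K n) : totalBoundary K n v = ∑ j, cubeBoundary j v := by
  simp [totalBoundary]

lemma totalBoundary_totalBoundary (v : CubeChain K n) :
    totalBoundary K n (totalBoundary K n v) = 0 := by
  simp only [totalBoundary_apply, map_sum]
  rw [← Finset.sum_product']
  refine Finset.sum_involution (fun p _ => (p.2, p.1)) ?_ ?_ ?_ ?_
  · rintro ⟨j, k⟩ -
    by_cases h : j = k
    · subst h
      simp [cubeBoundary_cubeBoundary_self]
    · exact cubeBoundary_anticomm (Ne.symm h) v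
  · rintro ⟨j, k⟩ - h h'
    obtain rfl : k = j := congrArg Prod.fst h'
    exact h (cubeBoundary_cubeBoundary_self k v)
  · simp
  · simp

lemma totalBoundary_cubeHomotopy (j : Fin n) (v : CubeChain K n) :
    totalBoundary K n (cubeHomotopy j v) + cubeHomotopy j (totalBoundary K n v) =
      cubeBoundary j (cubeHomotopy j v) + cubeHomotopy j (cubeBoundary j v) := by
  simp only [totalBoundary_apply, map_sum]
  rw [← Finset.sum_add_distrib]
  refine Finset.sum_eq_single j (fun k _ hk => ?_) (by simp)
  rw [add_comm]
  exact cubeHomotopy_cubeBoundary_anticomm (Ne.symm hk) v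

/-- `(F, G)` is an `i`-dimensional face of the subcomplex of the cube whose vertices lie in `Γ`.
As `Γ` will be a lower set, it suffices to ask this of the largest vertex `F`. -/
def IsCubeFace (Γ : Set (Finset (Fin n))) (i : ℕ) (F G : Finset (Fin n)) : Prop :=
  F ∈ Γ ∧ G ⊆ F ∧ G.card = i

/-- The chain `v` is supported on the `i`-dimensional faces with vertices in `Γ`. -/
def IsCubeChainOn (Γ : Set (Finset (Fin n))) (i : ℕ) (v : CubeChain K n) : Prop :=
  ∀ F G, ¬ IsCubeFace Γ i F G → v F G = 0

lemma IsCubeChainOn.sub {Γ : Set (Finset (Fin n))} {i : ℕ} {v w : CubeChain K n}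
    (hv : IsCubeChainOn Γ i v) (hw : IsCubeChainOn Γ i w) : IsCubeChainOn Γ i (v - w) :=
  fun F G h => by rw [Pi.sub_apply, Pi.sub_apply, hv F G h, hw F G h, sub_zero]

lemma IsCubeChainOn.add {Γ : Set (Finset (Fin n))} {i : ℕ} {v w : CubeChain K n}
    (hv : IsCubeChainOn Γ i v) (hw : IsCubeChainOn Γ i w) : IsCubeChainOn Γ i (v + w) :=
  fun F G h => by rw [Pi.add_apply, Pi.add_apply, hv F G h, hw F G h, add_zero]

lemma isCubeFace_of_insert {Γ : Set (Finset (Fin n))} (hΓ : IsLowerSet Γ) {i : ℕ} {j : Fin n}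
    {F G : Finset (Fin n)} (hj : j ∉ G)
    (h : IsCubeFace Γ (i + 1) (insert j F) (insert j G)) : IsCubeFace Γ i F G := by
  obtain ⟨h1, h2, h3⟩ := h
  refine ⟨hΓ (Finset.subset_insert j F) h1, fun k hk => ?_, ?_⟩
  · exact Finset.mem_of_mem_insert_of_ne (h2 (Finset.mem_insert_of_mem hk))
      (fun hkj => hj (hkj ▸ hk))
  · rw [Finset.card_insert_of_notMem hj] at h3
    omega

lemma IsCubeChainOn.map_totalBoundary {Γ : Set (Finset (Fin n))} (hΓ : IsLowerSet Γ) {i : ℕ}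
    {v : CubeChain K n} (hv : IsCubeChainOn Γ (i + 1) v) :
    IsCubeChainOn Γ i (totalBoundary K n v) := by
  intro F G h
  rw [totalBoundary_apply, Finset.sum_apply, Finset.sum_apply]
  refine Finset.sum_eq_zero fun j _ => ?_
  rw [cubeBoundary_apply]
  split_ifs with hj
  · rfl
  · rw [hv _ _ (mt (isCubeFace_of_insert hΓ hj) h), mul_zero, smul_zero]

lemma IsCubeChainOn.totalBoundary_eq_zero {Γ : Set (Finset (Fin n))} {v : CubeChain K n}
    (hv : IsCubeChainOn Γ 0 v) : totalBoundary K n v = 0 := by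
  ext1 F; ext1 G
  rw [totalBoundary_apply, Finset.sum_apply, Finset.sum_apply]
  refine Finset.sum_eq_zero fun j _ => ?_
  rw [cubeBoundary_apply, hv _ _ (fun h => by simpa using h.2.2), mul_zero, smul_zero, ite_self]

lemma IsCubeChainOn.map_cubeHomotopy {Γ : Set (Finset (Fin n))} {i : ℕ} {v : CubeChain K n}
    (hv : IsCubeChainOn Γ i v) (j : Fin n) : IsCubeChainOn Γ (i + 1) (cubeHomotopy j v) := by
  intro F G h
  rw [cubeHomotopy_apply]
  split_ifs with hj
  · rw [hv, map_zero, smul_zero]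
    rintro ⟨h1, h2, h3⟩
    refine h ⟨h1, ?_, ?_⟩
    · rw [← Finset.insert_erase hj.2]
      exact Finset.insert_subset hj.1 h2
    · rw [← h3, Finset.card_erase_add_one hj.2]
  · rfl

/-- A chain is reduced in direction `j` if its faces do not contain this direction and, on the
upper facet of the cube in this direction, no coefficient contains a monomial divisible by `y_j`. -/
def IsReducedIn (j : Fin n) (v : CubeChain K n) : Prop :=
  (∀ F G, j ∈ G → v F G = 0) ∧ ∀ F G, j ∈ F → divX (Sum.inr j) (v F G) = 0

/-- A cycle can be reduced in any direction within its homology class, without losing the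
reductions in other directions. -/
lemma isReducedIn_sub_totalBoundary_cubeHomotopy {Γ : Set (Finset (Fin n))} {i : ℕ}
    {v : CubeChain K n} (hv : IsCubeChainOn Γ i v) (hd : totalBoundary K n v = 0) (j : Fin n) :
    IsReducedIn j (v - totalBoundary K n (cubeHomotopy j v)) ∧
      ∀ k, IsReducedIn k v → IsReducedIn k (v - totalBoundary K n (cubeHomotopy j v)) := by
  have key : ∀ F G, (v - totalBoundary K n (cubeHomotopy j v)) F G =
      if j ∈ G then 0 else
        v F G - facetCoeff K j F * divX (Sum.inr j) (v (insert j F) G) := by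
    intro F G
    have h := totalBoundary_cubeHomotopy j v
    rw [hd, map_zero, add_zero] at h
    rw [h, ← sub_sub, cubeHomotopy_cubeBoundary_self]
    split_ifs with hG hF
    · rfl
    · exact hv F G fun h => hF (h.2.1 hG)
    · rfl
  have self : IsReducedIn j (v - totalBoundary K n (cubeHomotopy j v)) := by
    refine ⟨fun F G hG => by rw [key, if_pos hG], fun F G hF => ?_⟩
    rw [key]
    split_ifs with hG
    · exact map_zero _
    · rw [Finset.insert_eq_of_mem hF, facetCoeff, if_pos hF, divX_sub_X_mul_divX]
  refine ⟨self, fun k hk => ?_⟩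
  by_cases hkj : k = j
  · exact hkj ▸ self
  refine ⟨fun F G hG => ?_, fun F G hF => ?_⟩
  · rw [key, hk.1 F G hG, hk.1 _ G hG, map_zero, mul_zero, sub_zero, ite_self]
  · rw [key]
    split_ifs with hG
    · exact map_zero _
    · rw [map_sub, hk.2 F G hF, divX_facetCoeff_mul hkj, divX_comm,
        hk.2 _ G (Finset.mem_insert_of_mem hF), map_zero, mul_zero, sub_zero]

/-- Every cycle is homologous to one that is reduced in every direction. -/
lemma exists_isReducedIn_sub_totalBoundary {Γ : Set (Finset (Fin n))} (hΓ : IsLowerSet Γ) {i : ℕ}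
    {v : CubeChain K n} (hv : IsCubeChainOn Γ i v) (hd : totalBoundary K n v = 0) :
    ∃ w, IsCubeChainOn Γ (i + 1) w ∧ ∀ j, IsReducedIn j (v - totalBoundary K n w) := by
  suffices H : ∀ s : Finset (Fin n), ∃ w, IsCubeChainOn Γ (i + 1) w ∧
      ∀ j ∈ s, IsReducedIn j (v - totalBoundary K n w) by
    obtain ⟨w, hw, h⟩ := H Finset.univ
    exact ⟨w, hw, fun j => h j (Finset.mem_univ j)⟩
  intro s
  induction s using Finset.induction_on with
  | empty => exact ⟨0, fun _ _ _ => rfl, by simp⟩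
  | insert j s _ ih =>
    obtain ⟨w, hw, h⟩ := ih
    have hv' : IsCubeChainOn Γ i (v - totalBoundary K n w) := hv.sub (hw.map_totalBoundary hΓ)
    have hd' : totalBoundary K n (v - totalBoundary K n w) = 0 := by
      rw [map_sub, hd, totalBoundary_totalBoundary, sub_zero]
    obtain ⟨h1, h2⟩ := isReducedIn_sub_totalBoundary_cubeHomotopy hv' hd' j
    refine ⟨w + cubeHomotopy j (v - totalBoundary K n w), hw.add (hv'.map_cubeHomotopy j), ?_⟩
    rw [map_add, ← sub_sub]
    intro k hk
    rcases Finset.mem_insert.1 hk with rfl | hk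
    · exact h1
    · exact h2 k (h k hk)

/-- A chain that is reduced in every direction lives on the vertices of the cube. -/
lemma eq_zero_of_isReducedIn {v : CubeChain K n} (h : ∀ j, IsReducedIn j v) {G : Finset (Fin n)}
    (hG : G.Nonempty) (F : Finset (Fin n)) : v F G = 0 :=
  let ⟨j, hj⟩ := hG
  (h j).1 F G hj

lemma exists_totalBoundary_eq {Γ : Set (Finset (Fin n))} (hΓ : IsLowerSet Γ) {i : ℕ}
    {v : CubeChain K n} (hv : IsCubeChainOn Γ (i + 1) v) (hd : totalBoundary K n v = 0) :
    ∃ w, IsCubeChainOn Γ (i + 2) w ∧ totalBoundary K n w = v := by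
  obtain ⟨w, hw, h⟩ := exists_isReducedIn_sub_totalBoundary hΓ hv hd
  refine ⟨w, hw, (sub_eq_zero.1 ?_).symm⟩
  ext1 F; ext1 G
  by_cases hG : G.Nonempty
  · exact eq_zero_of_isReducedIn h hG F
  · refine (hv.sub (hw.map_totalBoundary hΓ)) F G fun hf => hG ?_
    exact Finset.card_pos.1 (by rw [hf.2.2]; omega)

end Acyclic

/-! ### The augmentation -/

section Augmentation

variable {K : Type*} [Field K] {n : ℕ}

/-- The exponent vector of the monomial `u_F`. -/
noncomputable def faceExponent (F : Finset (Fin n)) : Fin n ⊕ Fin n →₀ ℕ :=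
  Finsupp.equivFunOnFinite.symm
    (Sum.elim (fun i => if i ∈ F then 1 else 0) (fun i => if i ∈ F then 0 else 1))

lemma faceMonomial_eq_monomial (F : Finset (Fin n)) :
    faceMonomial K F = MvPolynomial.monomial (faceExponent F) 1 := by
  rw [MvPolynomial.monomial_eq, Finsupp.prod_fintype _ _ (by simp), Fintype.prod_sum_type]
  simp [faceExponent, faceMonomial, pow_ite, Finset.prod_ite,
    Finset.filter_notMem_eq_sdiff, Finset.compl_eq_univ_sdiff]

lemma degree_faceExponent (F : Finset (Fin n)) : (faceExponent F).degree = n := by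
  rw [Finsupp.degree_eq_sum, Fintype.sum_sum_type, ← Finset.sum_add_distrib]
  refine (Finset.sum_congr rfl (g := fun _ => 1) fun i _ => ?_).trans (by simp)
  simp only [faceExponent, Finsupp.equivFunOnFinite_symm_apply_apply, Sum.elim_inl, Sum.elim_inr]
  split_ifs <;> rfl

lemma X_inr_mul_faceMonomial_insert {j : Fin n} {F : Finset (Fin n)} (h : j ∉ F) :
    MvPolynomial.X (Sum.inr j) * faceMonomial K (insert j F) =
      MvPolynomial.X (Sum.inl j) * faceMonomial K F := by
  rw [faceMonomial, faceMonomial, Finset.prod_insert h, Finset.compl_insert,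
    ← Finset.mul_prod_erase Fᶜ _ (Finset.mem_compl.2 h)]
  ring

/-- The augmentation: the vertex `F` is sent to `u_F`, faces of positive dimension to zero. -/
noncomputable def cubeAugmentation (K : Type*) [Field K] (n : ℕ) :
    CubeChain K n →ₗ[MvPolynomial (Fin n ⊕ Fin n) K] MvPolynomial (Fin n ⊕ Fin n) K where
  toFun v := ∑ F, v F ∅ * faceMonomial K F
  map_add' v w := by simp [add_mul, Finset.sum_add_distrib]
  map_smul' a v := by simp [mul_assoc, Finset.mul_sum]

lemma cubeAugmentation_apply (v : CubeChain K n) :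
    cubeAugmentation K n v = ∑ F, v F ∅ * faceMonomial K F := rfl

/-- Both endpoints of an edge of the cube contribute the same monomial, with opposite signs. -/
lemma cubeAugmentation_totalBoundary (v : CubeChain K n) :
    cubeAugmentation K n (totalBoundary K n v) = 0 := by
  rw [totalBoundary_apply, map_sum]
  refine Finset.sum_eq_zero fun j _ => ?_
  rw [cubeAugmentation_apply]
  have hmem : ∀ F ∈ (Finset.univ.erase j).powerset, j ∉ F := fun F hF hj => by
    simpa using Finset.mem_powerset.1 hF hj
  rw [← Finset.powerset_univ, ← Finset.insert_erase (Finset.mem_univ j),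
    Finset.sum_powerset_insert (by simp), ← Finset.sum_add_distrib]
  refine Finset.sum_eq_zero fun F hF => ?_
  simp only [cubeBoundary_apply, facetCoeff, Finset.notMem_empty, if_false, hmem F hF,
    Finset.mem_insert_self, if_true, Finset.insert_idem, insert_empty_eq, smul_mul_assoc]
  rw [← smul_add, mul_right_comm (MvPolynomial.X (Sum.inr j)),
    X_inr_mul_faceMonomial_insert (hmem F hF)]
  convert smul_zero _
  ring

/-- On chains that are reduced in every direction the augmentation is injective: if no monomial of
the coefficient of `F` is divisible by `y_j` with `j ∈ F`, then `F` can be read off from every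
monomial of the product of that coefficient with `u_F`. -/
lemma eq_zero_of_cubeAugmentation_eq_zero {v : CubeChain K n} (h : ∀ j, IsReducedIn j v)
    (ha : cubeAugmentation K n v = 0) (F : Finset (Fin n)) : v F ∅ = 0 := by
  ext m
  rw [MvPolynomial.coeff_zero]
  by_contra hm
  have hred : ∀ (F' : Finset (Fin n)) (j : Fin n) (m' : Fin n ⊕ Fin n →₀ ℕ), j ∈ F' →
      m' (Sum.inr j) ≠ 0 → MvPolynomial.coeff m' (v F' ∅) = 0 := by
    intro F' j m' hj hm'
    have := congrArg (MvPolynomial.coeff (m' - Finsupp.single (Sum.inr j) 1)) ((h j).2 F' ∅ hj)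
    rwa [coeff_divX, add_tsub_cancel_of_le, MvPolynomial.coeff_zero] at this
    simpa [Nat.one_le_iff_ne_zero] using hm'
  have hc := congrArg (MvPolynomial.coeff (m + faceExponent F)) ha
  rw [cubeAugmentation_apply, MvPolynomial.coeff_sum, Finset.sum_eq_single F,
    MvPolynomial.coeff_zero, faceMonomial_eq_monomial, MvPolynomial.coeff_mul_monomial,
    mul_one] at hc
  · exact hm hc
  · intro F' _ hne
    rw [faceMonomial_eq_monomial, MvPolynomial.coeff_mul_monomial', mul_one]
    split_ifs with hle
    · by_cases hsub : F' ⊆ F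
      · obtain ⟨j, hj, hj'⟩ : ∃ j ∈ F, j ∉ F' := Finset.not_subset.1 fun hh =>
          hne (Finset.Subset.antisymm hsub hh)
        refine absurd (hred F j m hj ?_) hm
        have := hle (Sum.inr j)
        simp [faceExponent, hj, hj'] at this
        omega
      · obtain ⟨j, hj', hj⟩ := Finset.not_subset.1 hsub
        refine hred F' j _ hj' ?_
        simp [faceExponent, hj, hj']
    · rfl
  · simp

lemma exists_totalBoundary_eq_of_cubeAugmentation_eq_zero {Γ : Set (Finset (Fin n))}
    (hΓ : IsLowerSet Γ) {v : CubeChain K n} (hv : IsCubeChainOn Γ 0 v)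
    (ha : cubeAugmentation K n v = 0) :
    ∃ w, IsCubeChainOn Γ 1 w ∧ totalBoundary K n w = v := by
  obtain ⟨w, hw, h⟩ := exists_isReducedIn_sub_totalBoundary hΓ hv hv.totalBoundary_eq_zero
  refine ⟨w, hw, (sub_eq_zero.1 ?_).symm⟩
  ext1 F; ext1 G
  rcases G.eq_empty_or_nonempty with rfl | hG
  · refine eq_zero_of_cubeAugmentation_eq_zero h ?_ F
    rw [map_sub, ha, cubeAugmentation_totalBoundary, sub_zero]
  · exact eq_zero_of_isReducedIn h hG F

end Augmentation

/-! ### The linear resolution -/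

section Resolution

variable {K : Type*} [Field K] {n : ℕ}

/-- The `i`-dimensional faces of the subcomplex of the cube with vertices in `Γ`. -/
abbrev CubeFace (Γ : Set (Finset (Fin n))) (i : ℕ) : Type :=
  {p : Finset (Fin n) × Finset (Fin n) // IsCubeFace Γ i p.1 p.2}

/-- Restriction of chains to the `i`-dimensional faces with vertices in `Γ`. -/
noncomputable def cubeRestrict (K : Type*) [Field K] (Γ : Set (Finset (Fin n))) (i : ℕ) :
    CubeChain K n →ₗ[MvPolynomial (Fin n ⊕ Fin n) K]
      (CubeFace Γ i → MvPolynomial (Fin n ⊕ Fin n) K) where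
  toFun v p := v p.1.1 p.1.2
  map_add' _ _ := rfl
  map_smul' _ _ := rfl

open Classical in
/-- Extension by zero of chains on the `i`-dimensional faces with vertices in `Γ`. -/
noncomputable def cubeExtend (K : Type*) [Field K] (Γ : Set (Finset (Fin n))) (i : ℕ) :
    (CubeFace Γ i → MvPolynomial (Fin n ⊕ Fin n) K) →ₗ[MvPolynomial (Fin n ⊕ Fin n) K]
      CubeChain K n where
  toFun v F G := if h : IsCubeFace Γ i F G then v ⟨(F, G), h⟩ else 0
  map_add' v w := by
    ext1 F; ext1 G
    simp only [Pi.add_apply]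
    split_ifs <;> simp
  map_smul' a v := by
    ext1 F; ext1 G
    simp only [Pi.smul_apply, RingHom.id_apply]
    split_ifs <;> simp

lemma cubeExtend_apply_of_isCubeFace {Γ : Set (Finset (Fin n))} {i : ℕ} {F G : Finset (Fin n)}
    (h : IsCubeFace Γ i F G) (v : CubeFace Γ i → MvPolynomial (Fin n ⊕ Fin n) K) :
    cubeExtend K Γ i v F G = v ⟨(F, G), h⟩ := dif_pos h

lemma isCubeChainOn_cubeExtend {Γ : Set (Finset (Fin n))} {i : ℕ}
    (v : CubeFace Γ i → MvPolynomial (Fin n ⊕ Fin n) K) :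
    IsCubeChainOn Γ i (cubeExtend K Γ i v) :=
  fun _ _ h => dif_neg h

lemma cubeRestrict_cubeExtend {Γ : Set (Finset (Fin n))} {i : ℕ}
    (v : CubeFace Γ i → MvPolynomial (Fin n ⊕ Fin n) K) :
    cubeRestrict K Γ i (cubeExtend K Γ i v) = v := by
  ext1 p
  exact cubeExtend_apply_of_isCubeFace p.2 v

lemma cubeExtend_cubeRestrict {Γ : Set (Finset (Fin n))} {i : ℕ} {v : CubeChain K n}
    (hv : IsCubeChainOn Γ i v) : cubeExtend K Γ i (cubeRestrict K Γ i v) = v := by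
  ext1 F; ext1 G
  by_cases h : IsCubeFace Γ i F G
  · exact cubeExtend_apply_of_isCubeFace h _
  · rw [isCubeChainOn_cubeExtend _ F G h, hv F G h]

/-- The differential of the cubical resolution. -/
noncomputable def cubeDifferential (K : Type*) [Field K] (Γ : Set (Finset (Fin n))) (i : ℕ) :
    (CubeFace Γ (i + 1) → MvPolynomial (Fin n ⊕ Fin n) K) →ₗ[MvPolynomial (Fin n ⊕ Fin n) K]
      (CubeFace Γ i → MvPolynomial (Fin n ⊕ Fin n) K) :=
  cubeRestrict K Γ i ∘ₗ totalBoundary K n ∘ₗ cubeExtend K Γ (i + 1)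

lemma cubeDifferential_apply {Γ : Set (Finset (Fin n))} {i : ℕ}
    (v : CubeFace Γ (i + 1) → MvPolynomial (Fin n ⊕ Fin n) K) (p : CubeFace Γ i) :
    cubeDifferential K Γ i v p = ∑ j, if j ∈ p.1.2 then 0 else cubeSign j p.1.2 •
      (facetCoeff K j p.1.1 * cubeExtend K Γ (i + 1) v (insert j p.1.1) (insert j p.1.2)) := by
  change totalBoundary K n _ _ _ = _
  rw [totalBoundary_apply, Finset.sum_apply, Finset.sum_apply]
  rfl

lemma cubeExtend_cubeDifferential {Γ : Set (Finset (Fin n))} (hΓ : IsLowerSet Γ) {i : ℕ}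
    (v : CubeFace Γ (i + 1) → MvPolynomial (Fin n ⊕ Fin n) K) :
    cubeExtend K Γ i (cubeDifferential K Γ i v) =
      totalBoundary K n (cubeExtend K Γ (i + 1) v) :=
  cubeExtend_cubeRestrict ((isCubeChainOn_cubeExtend v).map_totalBoundary hΓ)

lemma exact_cubeDifferential {Γ : Set (Finset (Fin n))} (hΓ : IsLowerSet Γ) (i : ℕ) :
    Function.Exact (cubeDifferential K Γ (i + 1)) (cubeDifferential K Γ i) := by
  intro v
  constructor
  · intro h
    have hd : totalBoundary K n (cubeExtend K Γ (i + 1) v) = 0 := by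
      rw [← cubeExtend_cubeDifferential hΓ, h, map_zero]
    obtain ⟨w, hw, hwv⟩ := exists_totalBoundary_eq hΓ (isCubeChainOn_cubeExtend v) hd
    refine ⟨cubeRestrict K Γ (i + 2) w, ?_⟩
    rw [cubeDifferential, LinearMap.comp_apply, LinearMap.comp_apply,
      cubeExtend_cubeRestrict hw, hwv, cubeRestrict_cubeExtend]
  · rintro ⟨w, rfl⟩
    rw [cubeDifferential, LinearMap.comp_apply, LinearMap.comp_apply,
      cubeExtend_cubeDifferential hΓ, totalBoundary_totalBoundary, map_zero]

lemma exact_cubeAugmentation {Γ : Set (Finset (Fin n))} (hΓ : IsLowerSet Γ) :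
    Function.Exact (cubeDifferential K Γ 0) (cubeAugmentation K n ∘ₗ cubeExtend K Γ 0) := by
  intro v
  constructor
  · intro h
    obtain ⟨w, hw, hwv⟩ := exists_totalBoundary_eq_of_cubeAugmentation_eq_zero hΓ
      (isCubeChainOn_cubeExtend v) h
    refine ⟨cubeRestrict K Γ 1 w, ?_⟩
    rw [cubeDifferential, LinearMap.comp_apply, LinearMap.comp_apply,
      cubeExtend_cubeRestrict hw, hwv, cubeRestrict_cubeExtend]
  · rintro ⟨w, rfl⟩
    rw [LinearMap.comp_apply, cubeExtend_cubeDifferential hΓ, cubeAugmentation_totalBoundary]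

lemma isCubeFace_zero_empty_iff {Γ : Set (Finset (Fin n))} {F : Finset (Fin n)} :
    IsCubeFace Γ 0 F ∅ ↔ F ∈ Γ := by
  simp [IsCubeFace]

lemma range_cubeAugmentation (Γ : Set (Finset (Fin n))) :
    LinearMap.range (cubeAugmentation K n ∘ₗ cubeExtend K Γ 0) =
      Ideal.span (faceMonomial K '' Γ) := by
  apply le_antisymm
  · rintro _ ⟨v, rfl⟩
    rw [LinearMap.comp_apply, cubeAugmentation_apply]
    refine Ideal.sum_mem _ fun F _ => ?_
    by_cases hF : F ∈ Γ
    · exact Ideal.mul_mem_left _ _ (Ideal.subset_span ⟨F, hF, rfl⟩)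
    · rw [isCubeChainOn_cubeExtend v F ∅ (mt isCubeFace_zero_empty_iff.1 hF), zero_mul]
      exact Ideal.zero_mem _
  · refine Ideal.span_le.2 ?_
    rintro _ ⟨F, hF, rfl⟩
    let v : CubeChain K n := fun F' G' => if F' = F ∧ G' = ∅ then 1 else 0
    have hv : IsCubeChainOn Γ 0 v := fun F' G' h => by
      refine if_neg ?_
      rintro ⟨rfl, rfl⟩
      exact h (isCubeFace_zero_empty_iff.2 hF)
    refine ⟨cubeRestrict K Γ 0 v, ?_⟩
    rw [LinearMap.comp_apply, cubeExtend_cubeRestrict hv, cubeAugmentation_apply]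
    simp [v]

/-- The extension by zero of a homogeneous vector has homogeneous coordinates. -/
lemma degree_add_eq_of_mem_support_cubeExtend {Γ : Set (Finset (Fin n))} {i : ℕ} {c j : ℤ}
    {v : CubeFace Γ i → MvPolynomial (Fin n ⊕ Fin n) K}
    (hv : IsHomogeneousVector (fun _ => c) j v) (F G : Finset (Fin n))
    {m : Fin n ⊕ Fin n →₀ ℕ} (hm : m ∈ (cubeExtend K Γ i v F G).support) :
    (m.degree : ℤ) + c = j := by
  by_cases h : IsCubeFace Γ i F G
  · rw [cubeExtend_apply_of_isCubeFace h] at hm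
    exact hv _ m hm
  · simp [isCubeChainOn_cubeExtend v F G h] at hm

lemma degree_of_mem_support_cubeAugmentation {Γ : Set (Finset (Fin n))} {j : ℤ}
    {v : CubeFace Γ 0 → MvPolynomial (Fin n ⊕ Fin n) K}
    (hv : IsHomogeneousVector (fun _ => (n : ℤ)) j v) {m : Fin n ⊕ Fin n →₀ ℕ}
    (hm : m ∈ ((cubeAugmentation K n ∘ₗ cubeExtend K Γ 0) v).support) :
    (m.degree : ℤ) = j := by
  classical
  rw [LinearMap.comp_apply, cubeAugmentation_apply] at hm
  obtain ⟨F, -, hF⟩ := Finset.mem_biUnion.1 (MvPolynomial.support_sum hm)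
  obtain ⟨a, ha, b, hb, rfl⟩ := Finset.mem_add.1 (MvPolynomial.support_mul _ _ hF)
  rw [faceMonomial_eq_monomial] at hb
  obtain rfl := Finset.mem_singleton.1 (MvPolynomial.support_monomial_subset hb)
  have := degree_add_eq_of_mem_support_cubeExtend hv F ∅ ha
  rw [map_add, degree_faceExponent]
  push_cast
  exact this

lemma degree_of_mem_support_facetCoeff {j : Fin n} {F : Finset (Fin n)}
    {m : Fin n ⊕ Fin n →₀ ℕ} (hm : m ∈ (facetCoeff K j F).support) : m.degree = 1 := by
  unfold facetCoeff at hm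
  split_ifs at hm
  · rw [MvPolynomial.support_X, Finset.mem_singleton] at hm
    simp [hm]
  · rw [MvPolynomial.support_neg, MvPolynomial.support_X, Finset.mem_singleton] at hm
    simp [hm]

lemma isHomogeneousVector_cubeDifferential {Γ : Set (Finset (Fin n))} {i : ℕ} {c j : ℤ}
    {v : CubeFace Γ (i + 1) → MvPolynomial (Fin n ⊕ Fin n) K}
    (hv : IsHomogeneousVector (fun _ => c + 1) j v) :
    IsHomogeneousVector (fun _ => c) j (cubeDifferential K Γ i v) := by
  classical
  intro p m hm
  rw [cubeDifferential_apply] at hm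
  obtain ⟨k, -, hk⟩ := Finset.mem_biUnion.1 (MvPolynomial.support_sum hm)
  split_ifs at hk with hkp
  · simp at hk
  · obtain ⟨a, ha, b, hb, rfl⟩ := Finset.mem_add.1
      (MvPolynomial.support_mul _ _ (MvPolynomial.support_smul hk))
    have := degree_add_eq_of_mem_support_cubeExtend hv _ _ hb
    rw [map_add, degree_of_mem_support_facetCoeff ha]
    push_cast
    linarith

lemma constantCoeff_cubeDifferential {Γ : Set (Finset (Fin n))} {i : ℕ}
    (v : CubeFace Γ (i + 1) → MvPolynomial (Fin n ⊕ Fin n) K) (p : CubeFace Γ i) :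
    MvPolynomial.constantCoeff (cubeDifferential K Γ i v p) = 0 := by
  have h : ∀ (j : Fin n) (F : Finset (Fin n)),
      MvPolynomial.constantCoeff (facetCoeff K j F) = 0 := by
    intro j F
    unfold facetCoeff
    split_ifs <;> simp
  rw [cubeDifferential_apply, map_sum]
  refine Finset.sum_eq_zero fun j _ => ?_
  split_ifs
  · exact map_zero _
  · rw [map_zsmul, map_mul, h, zero_mul, smul_zero]

/-- The cubical resolution of the ideal generated by the monomials `u_F`, where `F` runs through
a lower set: the basis of its `i`-th module is the set of `i`-dimensional faces of the subcomplex
of the cube with vertices in this lower set. -/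
noncomputable def cubeResolution (K : Type*) [Field K] {Γ : Set (Finset (Fin n))}
    (hΓ : IsLowerSet Γ) : GradedFreeResolution (Ideal.span (faceMonomial K '' Γ)) where
  ι := CubeFace Γ
  finite_ι _ := inferInstance
  deg i _ := n + i
  aug := cubeAugmentation K n ∘ₗ cubeExtend K Γ 0
  d := cubeDifferential K Γ
  aug_homogeneous j v hv m hm :=
    degree_of_mem_support_cubeAugmentation (by simpa using hv) hm
  d_homogeneous i j v hv :=
    isHomogeneousVector_cubeDifferential (by simpa [add_assoc] using hv)
  range_aug := range_cubeAugmentation Γ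
  exact_aug := exact_cubeAugmentation hΓ
  exact_d := exact_cubeDifferential hΓ

lemma isLowerSet_insert_empty_faces (Δ : PreAbstractSimplicialComplex (Fin n)) :
    IsLowerSet (insert ∅ Δ.faces) := by
  rintro F G hGF hF
  rcases G.eq_empty_or_nonempty with rfl | hG
  · exact Set.mem_insert _ _
  · rcases hF with rfl | hF
    · exact absurd (Finset.subset_empty.1 hGF) hG.ne_empty
    · exact Set.mem_insert_of_mem _ ((Δ.isRelLowerSet_faces hF).2 hGF hG)

end Resolution

theorem corollary1p2 (K : Type*) [Field K] (n : ℕ) (Δ : PreAbstractSimplicialComplex (Fin n)) :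
    HasLinearResolution (faceIdeal K Δ) :=
  ⟨n, cubeResolution K (isLowerSet_insert_empty_faces Δ),
    fun _ v p => constantCoeff_cubeDifferential v p, fun _ _ => rfl⟩
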